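/- Let $G=(V,E)$ be a finite multigraph (parallel edges allowed) that is bipartite, i.e. $V$ is the disjoint union of two sets $A$ and $B$ and every edge joins a vertex of $A$ to a vertex of $B$. The vertices are agents and the edges are indivisible goods. Each agent $i\in V$ has a valuation $v_i:2^E\to\mathbb{R}$ that is normalized, $v_i(\emptyset)=0$, and monotone, $v_i(S)\le v_i(T)$ whenever $S\subseteq T\subseteq E$, and that satisfies $v_i(S\cup\{g\})=v_i(S)$ for every $S\subseteq E$ and every edge $g\in E$ not incident to $i$. Then there is a complete EFX allocation: a family $(X_i)_{i\in V}$ of pairwise disjoint (possibly empty) sets with $\bigcup_{i\in V}X_i=E$ such that, for all $i,j\in V$ and every $g\in X_j$, $$v_i(X_i)\ \ge\ v_i(X_j\setminus\{g\}).$$ -/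

import Mathlib

open scoped Graph

namespace FairDivision

/-- A valuation function over a set `M` of goods: monotone and normalized. -/
structure IsValuation {M : Type*} (v : Set M → ℝ) : Prop where
  monotone : ∀ S T : Set M, S ⊆ T → v S ≤ v T
  empty : v ∅ = 0

/-- An allocation gives pairwise disjoint (possibly empty) bundles of goods to the agents;
goods may stay unallocated. -/
def IsAllocation {N M : Type*} (X : N → Set M) : Prop :=
  ∀ i j, i ≠ j → Disjoint (X i) (X j)

/-- A complete allocation is one in which every good is allocated. -/
structure IsCompleteAllocation {N M : Type*} (X : N → Set M) : Prop where
  allocation : IsAllocation X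
  complete : ∀ g : M, ∃ i, g ∈ X i

/-- Envy-freeness up to any good: no agent prefers to her own bundle the bundle of an agent
after the removal of any one good, including goods that she does not value. -/
def IsEFX {N M : Type*} (v : N → Set M → ℝ) (X : N → Set M) : Prop :=
  ∀ i j, ∀ g ∈ X j, v i (X j \ {g}) ≤ v i (X i)

/-- The multigraph setting: agents are the vertices of `G`, goods are its edges, every agent has
a valuation over all the goods, and an edge that is not incident to a vertex has zero marginal
value for it. -/
structure IsMultigraphSetting {α β : Type*} (G : Graph α β) (v : V(G) → Set E(G) → ℝ) : Prop where
  valuation : ∀ i, IsValuation (v i)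
  irrelevant : ∀ (i : V(G)) (g : E(G)) (S : Set E(G)), ¬ G.Inc g i → v i (S ∪ {g}) = v i S

/-- A multigraph is bipartite if its vertex set splits into two disjoint sides (possibly empty)
such that every edge joins a vertex of one side to a vertex of the other. -/
def IsBipartite {α β : Type*} (G : Graph α β) : Prop :=
  ∃ A B : Set α, A ∪ B = V(G) ∧ Disjoint A B ∧
    ∀ e x y, G.IsLink e x y → (x ∈ A ∧ y ∈ B) ∨ (x ∈ B ∧ y ∈ A)

end FairDivision

namespace FairDivision

/-! For `i` on the first side and `j` on the second, `j` cuts their common goods into two parts,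
either one acceptable to `j` up to any good when the other is kept. Each `i` marks its favourite
part over all `j`, cut by `f i`. Each `j` selects one part per neighbour, as valuable as possible
while sparing the parts marked at `j`.

Unselected parts return to the first side, but leftovers `L i` added to the marked part could make
`f i` envy `i`. If `i` values its marked part at least as much as the other part at `f i` together
with `L i`, then `L i` goes to `f i`, to whom it is worthless. Otherwise (`T i`), `i` keeps its
leftovers and `f i` may choose again at `i`: `i` is content with whichever part remains, and `f i`
holds a best choice. -/

/-- Every set of goods can be cut into two parts, each of which is envy-free up to any good
for a given monotone valuation. -/
theorem exists_efx_cut {M : Type*} [Finite M] {v : Set M → ℝ} (hv : Monotone v) (E : Set M) :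
    ∃ C ⊆ E, (∀ g ∈ C, v (C \ {g}) ≤ v (E \ C)) ∧ ∀ g ∈ E \ C, v ((E \ C) \ {g}) ≤ v C := by
  -- Make the worse part as valuable as possible, ties broken by size. If the complement minus `g`
  -- still beats `C`, moving `g` into `C` improves this: either `C` remains the worse part and
  -- grows, or the reduced complement becomes the worse part, with value above that of `C`.
  obtain ⟨C, ⟨hCE, hle⟩, hmax⟩ := Set.exists_max_image {C : Set M | C ⊆ E ∧ v C ≤ v (E \ C)}
    (fun C => toLex (v C, C.ncard)) (Set.toFinite _) ⟨∅, by simp, hv (Set.empty_subset _)⟩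
  refine ⟨C, hCE, fun g _ => (hv Set.sdiff_subset).trans hle, fun g hg => ?_⟩
  by_contra! hlt
  have hsub : insert g C ⊆ E := Set.insert_subset hg.1 hCE
  have hdiff : (E \ C) \ {g} = E \ insert g C := by
    ext x; simp only [Set.mem_sdiff, Set.mem_singleton_iff, Set.mem_insert_iff]; tauto
  rw [hdiff] at hlt
  rcases le_total (v (insert g C)) (v (E \ insert g C)) with h | h
  · have := hmax _ ⟨hsub, h⟩
    rw [Prod.Lex.toLex_le_toLex] at this
    rcases this with h1 | ⟨_, h1⟩
    · exact absurd (hv (Set.subset_insert g C)) (not_le.2 h1)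
    · simp only [Set.ncard_insert_of_notMem hg.2 (Set.toFinite C)] at h1
      omega
  · have := hmax (E \ insert g C) ⟨Set.sdiff_subset, by rwa [Set.sdiff_sdiff_cancel_left hsub]⟩
    rw [Prod.Lex.toLex_le_toLex] at this
    rcases this with h1 | ⟨h1, _⟩
    · exact lt_asymm hlt h1
    · exact hlt.ne' h1

/-- A good of zero marginal value to an agent may be discarded from every bundle. -/
theorem eq_inter_of_irrelevant {M : Type*} [Finite M] {v : Set M → ℝ} {R : Set M}
    (h : ∀ g S, g ∉ R → v (S ∪ {g}) = v S) (S : Set M) : v S = v (S ∩ R) := by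
  suffices H : ∀ T : Set M, T ⊆ Rᶜ → v (S ∩ R ∪ T) = v (S ∩ R) by
    rw [← H (S \ R) (fun x hx => hx.2), Set.inter_union_sdiff]
  intro T
  induction T, Set.toFinite T using Set.Finite.induction_on with
  | empty => simp
  | @insert g T _ _ ih =>
    intro hT
    rw [Set.insert_subset_iff] at hT
    rw [← Set.union_singleton, ← Set.union_assoc, h g _ hT.1, ih hT.2]

/-- There is a two-colouring of the goods that restricts, for all `i` and `j`, to a cut of the
goods between `i` and `j` that is envy-free up to any good for `j`. -/
theorem exists_efx_colouring {V M : Type*} [Finite M] (a b : M → V) {v : V → Set M → ℝ}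
    (hv : ∀ i, Monotone (v i)) :
    ∃ c : M → Bool, ∀ i j p, ∀ g ∈ {x | a x = i ∧ b x = j ∧ c x = p},
      v j ({x | a x = i ∧ b x = j ∧ c x = p} \ {g}) ≤
        v j {x | a x = i ∧ b x = j ∧ c x = !p} := by
  classical
  choose C hC hC1 hC2 using fun i j => exists_efx_cut (hv j) {x | a x = i ∧ b x = j}
  refine ⟨fun x => decide (x ∈ C (a x) (b x)), fun i j p => ?_⟩
  have ht : {x | a x = i ∧ b x = j ∧ decide (x ∈ C (a x) (b x)) = true} = C i j := by
    ext x
    simp only [Set.mem_ofPred_eq, decide_eq_true_eq]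
    constructor
    · rintro ⟨rfl, rfl, h⟩; exact h
    · intro h; obtain ⟨rfl, rfl⟩ := hC i j h; exact ⟨rfl, rfl, h⟩
  have hf : {x | a x = i ∧ b x = j ∧ decide (x ∈ C (a x) (b x)) = false} =
      {x | a x = i ∧ b x = j} \ C i j := by
    ext x
    simp only [Set.mem_ofPred_eq, decide_eq_false_iff_not, Set.mem_sdiff]
    constructor
    · rintro ⟨rfl, rfl, h⟩; exact ⟨⟨rfl, rfl⟩, h⟩
    · rintro ⟨⟨rfl, rfl⟩, h⟩; exact ⟨rfl, rfl, h⟩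
  cases p
  · rw [Bool.not_false, ht, hf]; exact hC2 i j
  · rw [Bool.not_true, ht, hf]; exact hC1 i j

/-- The bipartite case in terms of the map that sends a good to its owner: every good `g` joins
`a g` to `b g`, where the two endpoints lie on different sides. -/
theorem exists_efx_owner {V M : Type*} [Finite V] [Finite M] (side : V → Prop) (a b : M → V)
    (ha : ∀ g, side (a g)) (hb : ∀ g, ¬ side (b g)) (hB : ∃ j, ¬ side j) {v : V → Set M → ℝ}
    (hv : ∀ i, Monotone (v i)) (hR : ∀ i S, v i S = v i (S ∩ {g | a g = i ∨ b g = i})) :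
    ∃ o : M → V, ∀ k l, ∀ g ∈ {x | o x = l}, v k ({x | o x = l} \ {g}) ≤ v k {x | o x = k} := by
  classical
  have le_of : ∀ {i : V} {S T : Set M}, (∀ x ∈ S, a x = i ∨ b x = i → x ∈ T) → v i S ≤ v i T := by
    intro i S T h
    rw [hR i S]
    exact hv i fun x hx => h x hx.1 hx.2
  obtain ⟨c, hc⟩ := exists_efx_colouring a b hv
  let D : V → V → Bool → Set M := fun i j p => {x | a x = i ∧ b x = j ∧ c x = p}
  let K : V → (V → Bool) → Set M := fun j s => {x | b x = j ∧ c x = s (a x)}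
  have hDK : ∀ i j s, D i j (s i) ⊆ K j s := by
    rintro i j s x ⟨rfl, h2, h3⟩; exact ⟨h2, h3⟩
  -- the favourite part of each vertex on the first side
  have hbest : ∀ i, ∃ q : V × Bool, ¬ side q.1 ∧
      ∀ j p, ¬ side j → v i (D i j p) ≤ v i (D i q.1 q.2) := by
    intro i
    obtain ⟨j₀, hj₀⟩ := hB
    obtain ⟨q, hq, hmax⟩ := Set.exists_max_image {q : V × Bool | ¬ side q.1}
      (fun q => v i (D i q.1 q.2)) (Set.toFinite _) ⟨(j₀, true), hj₀⟩
    exact ⟨q, hq, fun j p hj => hmax (j, p) hj⟩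
  choose q hq hqmax using hbest
  let f : V → V := fun i => (q i).1
  let β : V → Bool := fun i => (q i).2
  have hf : ∀ i j p, ¬ side j → v i (D i j p) ≤ v i (D i (f i) (β i)) := hqmax
  -- the selection of each vertex on the second side, before and after the exchanges
  have hsel : ∀ j, ∃ s : V → Bool, (∀ i, f i = j → s i = !β i) ∧
      ∀ t : V → Bool, (∀ i, f i = j → t i = !β i) → v j (K j t) ≤ v j (K j s) := by
    intro j
    obtain ⟨s, hs, hmax⟩ := Set.exists_max_image {s : V → Bool | ∀ i, f i = j → s i = !β i}
      (fun s => v j (K j s)) (Set.toFinite _) ⟨fun i => !β i, fun _ _ => rfl⟩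
    exact ⟨s, hs, hmax⟩
  choose h₀ hh₀ hh₀max using hsel
  let L : V → Set M := fun i => {x | a x = i ∧ b x ≠ f i ∧ c x ≠ h₀ (b x) i}
  let T : V → Prop := fun i => v i (D i (f i) (β i)) < v i (D i (f i) (!β i) ∪ L i)
  have hsel' : ∀ j, ∃ s : V → Bool, (∀ i, ¬ (f i = j ∧ T i) → s i = h₀ j i) ∧
      ∀ t : V → Bool, (∀ i, ¬ (f i = j ∧ T i) → t i = h₀ j i) → v j (K j t) ≤ v j (K j s) := by
    intro j
    obtain ⟨s, hs, hmax⟩ := Set.exists_max_image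
      {s : V → Bool | ∀ i, ¬ (f i = j ∧ T i) → s i = h₀ j i}
      (fun s => v j (K j s)) (Set.toFinite _) ⟨h₀ j, fun _ _ => rfl⟩
    exact ⟨s, hs, hmax⟩
  choose h hh hhmax using hsel'
  have hh0 : ∀ i j, f i ≠ j → h j i = h₀ j i := fun i j hij => hh j i fun H => hij H.1
  have hhβ : ∀ i, ¬ T i → h (f i) i = !β i := fun i hi =>
    (hh _ i fun H => hi H.2).trans (hh₀ _ i rfl)
  have hKmax : ∀ j (t : V → Bool), (∀ i, f i = j → t i = !β i) → v j (K j t) ≤ v j (K j (h j)) :=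
    fun j t ht => (hh₀max j t ht).trans (hhmax j _ fun _ _ => rfl)
  -- When `T i` fails, `L i` must not stay with `i`: deleting a good of `L i` would leave the marked
  -- part whole, and the cut says nothing about `f i` and a whole part.
  let o : M → V := fun x =>
    if c x = h (b x) (a x) then b x else if f (a x) = b x ∨ T (a x) then a x else f (a x)
  have hK : ∀ j, v j (K j (h j)) ≤ v j {x | o x = j} := by
    refine fun j => hv j ?_
    rintro x ⟨rfl, hx⟩
    simp only [o, Set.mem_ofPred_eq, if_pos hx]
  have hC : ∀ i, v i (D i (f i) (β i)) ≤ v i {x | o x = i} := by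
    intro i
    by_cases hT : T i
    · by_cases hβ : h (f i) i = β i
      · refine hT.le.trans (hv i ?_)
        rintro x (⟨rfl, h2, h3⟩ | ⟨rfl, h2, h3⟩)
        · have : c x ≠ h (b x) (a x) := by rw [h2, hβ, h3]; simp
          simp only [o, Set.mem_ofPred_eq, if_neg this, hT, or_true, if_true]
        · have : c x ≠ h (b x) (a x) := by rwa [hh0 _ _ (Ne.symm h2)]
          simp only [o, Set.mem_ofPred_eq, if_neg this, hT, or_true, if_true]
      · refine hv i ?_
        rintro x ⟨rfl, h2, h3⟩
        have : c x ≠ h (b x) (a x) := by rw [h2, h3]; exact Ne.symm hβ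
        simp only [o, Set.mem_ofPred_eq, if_neg this, hT, or_true, if_true]
    · refine hv i ?_
      rintro x ⟨rfl, h2, h3⟩
      have : c x ≠ h (b x) (a x) := by rw [h2, h3, hhβ _ hT]; simp
      simp only [o, Set.mem_ofPred_eq, if_neg this, h2.symm, true_or, if_true]
  have ho : ∀ x l, o x = l → (b x = l ∧ c x = h l (a x)) ∨
      (a x = l ∧ c x = (!h (b x) l) ∧ (f l = b x ∨ T l)) ∨
      (f (a x) = l ∧ f (a x) ≠ b x ∧ ¬ T (a x) ∧ c x = !h (b x) (a x)) := by
    rintro x l rfl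
    simp only [o]
    split_ifs with h1 h2
    · exact Or.inl ⟨rfl, h1⟩
    · exact Or.inr (Or.inl ⟨rfl, Bool.eq_not.2 h1, h2⟩)
    · push Not at h2
      exact Or.inr (Or.inr ⟨rfl, h2.1, h2.2, Bool.eq_not.2 h1⟩)
  refine ⟨o, fun k l g hg => ?_⟩
  by_cases hkl : k = l
  · subst hkl; exact hv k Set.sdiff_subset
  by_cases hk : side k
  · refine (hv k Set.sdiff_subset).trans (le_trans ?_ (hC k))
    have hinc : ∀ x, a x = k ∨ b x = k → a x = k := fun x hx =>
      hx.resolve_right fun H => hb x (H ▸ hk)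
    by_cases hl : side l
    · refine le_of fun x hx hxk => ?_
      have h1 := hinc x hxk
      rcases ho x l hx with ⟨h2, _⟩ | ⟨h2, _⟩ | ⟨h2, _⟩
      · exact absurd (h2 ▸ hl) (hb x)
      · exact absurd (h1.symm.trans h2) hkl
      · exact absurd hl (h2 ▸ hq (a x))
    · by_cases hfl : f k = l ∧ ¬ T k
      · refine le_trans (le_of fun x hx hxk => ?_) (not_lt.1 hfl.2)
        have h1 := hinc x hxk
        subst h1
        rcases ho x l hx with ⟨h2, h3⟩ | ⟨h2, _⟩ | ⟨h2, h3, h4, h5⟩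
        · left
          refine ⟨rfl, h2.trans hfl.1.symm, ?_⟩
          rw [h3, ← hfl.1, hhβ _ hfl.2]
        · exact absurd (h2 ▸ hk) hl
        · right
          refine ⟨rfl, Ne.symm h3, ?_⟩
          rw [h5, hh0 _ _ h3]; simp
      · refine le_trans (le_of fun x hx hxk => ?_) (hf k l (h l k) hl)
        have h1 := hinc x hxk
        subst h1
        rcases ho x l hx with ⟨h2, h3⟩ | ⟨h2, _⟩ | ⟨h2, h3, h4, h5⟩
        · exact ⟨rfl, h2, h3⟩
        · exact absurd (h2 ▸ hk) hl
        · exact absurd ⟨h2, h4⟩ hfl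
  · have hinc : ∀ x, a x = k ∨ b x = k → b x = k := fun x hx =>
      hx.resolve_left fun H => hk (H ▸ ha x)
    refine le_trans ?_ (hK k)
    -- `s` collects every part that `k` failed to select outside the vertices tied to `k` by `f`. At
    -- those it takes the unmarked part, so it was admissible when `h₀ k` was chosen.
    let s : V → Bool := fun i => if f i = k then !β i else !h k i
    have hs : ∀ i, f i ≠ k → s i = !h k i := fun i hi => if_neg hi
    have hcompl : v k (K k s) ≤ v k (K k (h k)) := hKmax k s fun i hi => if_pos hi
    by_cases hfl : side l ∧ f l = k
    · obtain ⟨hl, hfl⟩ := hfl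
      have hsub : ∀ x, o x = l → a x = l ∧ c x = (!h (b x) l) ∧ (f l = b x ∨ T l) := by
        intro x hx
        rcases ho x l hx with ⟨h2, _⟩ | h2 | ⟨h2, _⟩
        · exact absurd (h2 ▸ hl) (hb x)
        · exact h2
        · exact absurd hl (h2 ▸ hq (a x))
      by_cases hT : T l
      -- Since `k` chose again at `l`, switching to the other part there cannot gain, and that part
      -- alone contains all that `k` can value in the bundle of `l`.
      · refine (hv k Set.sdiff_subset).trans (le_trans (le_of fun x hx hxk => ?_)
          (hhmax k (Function.update (h k) l (!h k l)) fun i hi => ?_))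
        · obtain ⟨h1, h2, _⟩ := hsub x hx
          have h3 := hinc x hxk
          exact ⟨h3, by rw [h1, Function.update_self, h2, h3]⟩
        · have : i ≠ l := by rintro rfl; exact hi ⟨hfl, hT⟩
          rw [Function.update_of_ne this]
          exact hh k i hi
      · have hβ := hhβ l hT
        rw [hfl] at hβ
        have hsub' : {x | o x = l} ⊆ D l k (β l) := by
          intro x hx
          obtain ⟨h1, h2, h3⟩ := hsub x hx
          have h4 : b x = k := (h3.resolve_right hT).symm.trans hfl
          exact ⟨h1, h4, by rw [h2, h4, hβ, Bool.not_not]⟩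
        -- The only case that needs the deletion of `g`: the bundle lies in one part of a cut made
        -- by `k`, who holds the other part.
        refine (hv k (Set.sdiff_subset_sdiff_left hsub')).trans
          ((hc l k (β l) g (hsub' hg)).trans (hv k ?_))
        have := hDK l k (h k)
        rwa [hβ] at this
    · refine (hv k Set.sdiff_subset).trans (le_trans (le_of fun x hx hxk => ?_) hcompl)
      have h1 := hinc x hxk
      refine ⟨h1, ?_⟩
      rcases ho x l hx with ⟨h2, _⟩ | ⟨h2, h3, _⟩ | ⟨h2, h3, h4, h5⟩
      · exact absurd (h1.symm.trans h2) hkl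
      · have : f (a x) ≠ k := fun H => hfl ⟨h2 ▸ ha x, h2 ▸ H⟩
        rw [hs _ this, h3, h1, h2]
      · have : f (a x) ≠ k := fun H => h3 (H.trans h1.symm)
        rw [hs _ this, h5, h1]

end FairDivision

theorem theorem1 {α β : Type*} (G : Graph α β) (hV : V(G).Finite) (hE : E(G).Finite)
    (hG : FairDivision.IsBipartite G) (v : V(G) → Set E(G) → ℝ)
    (hv : FairDivision.IsMultigraphSetting G v) :
    ∃ X : V(G) → Set E(G), FairDivision.IsCompleteAllocation X ∧ FairDivision.IsEFX v X := by
  have := hV.to_subtype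
  have := hE.to_subtype
  obtain ⟨A, B, hAB, hdisj, hlink⟩ := hG
  have hends : ∀ g : E(G), ∃ x y : V(G), G.IsLink g x y ∧ (x : α) ∈ A ∧ (y : α) ∈ B := by
    intro g
    obtain ⟨x, y, hxy⟩ := Graph.exists_isLink_of_mem_edgeSet g.2
    rcases hlink _ _ _ hxy with ⟨hx, hy⟩ | ⟨hx, hy⟩
    · exact ⟨⟨x, hxy.left_mem⟩, ⟨y, hxy.right_mem⟩, hxy, hx, hy⟩
    · exact ⟨⟨y, hxy.right_mem⟩, ⟨x, hxy.left_mem⟩, hxy.symm, hy, hx⟩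
  choose a b hab haA hbB using hends
  -- Favourite parts, possibly empty, need some vertex on the second side; without one there are no
  -- goods.
  by_cases hB : ∃ j : V(G), ¬ (j : α) ∈ A
  · obtain ⟨o, ho⟩ := FairDivision.exists_efx_owner (fun i : V(G) => (i : α) ∈ A) a b haA
      (fun g => Set.disjoint_right.1 hdisj (hbB g)) hB (v := v)
      (fun i S T => (hv.valuation i).monotone S T) (fun i S => by
        refine FairDivision.eq_inter_of_irrelevant (fun g S hg => hv.irrelevant i g S ?_) S
        rintro ⟨y, hy⟩
        refine hg ?_
        rcases hy.left_eq_or_eq (hab g) with H | H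
        · exact Or.inl (Subtype.ext H.symm)
        · exact Or.inr (Subtype.ext H.symm))
    refine ⟨fun i => {x | o x = i}, ⟨fun i j hij => ?_, fun g => ⟨o g, rfl⟩⟩, ho⟩
    exact Set.disjoint_left.2 fun x hi hj => hij (hi.symm.trans hj)
  · push Not at hB
    exact ⟨fun _ => ∅, ⟨fun _ _ _ => disjoint_bot_left, fun g =>
      absurd (hB (b g)) (Set.disjoint_right.1 hdisj (hbB g))⟩, fun _ _ _ hg => hg.elim⟩
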